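/- An influence graph $G=(V,E,(p_{uv})_{(u,v)\in E})$ is a finite nonempty directed graph with an activation probability $p_{uv}\in[0,1]$ on every edge. The live-edge graph $L$ of $G$ is the random subgraph that contains each edge $(u,v)\in E$ with probability $p_{uv}$, independently of the other edges, and $R(S,L)$ is the set of nodes reachable in $L$ from some node of $S\subseteq V$ (independent cascade model). Put $\sigma(S)=\mathbb{E}_L[|R(S,L)|]$. For an integer $k\ge 1$ let $OPT_N(G,k)$ be the maximum of $\sigma(S)$ over all $S\subseteq V$ with $|S|=k$. An adaptive policy $\pi$ with full-adoption feedback selects seeds one at a time: knowing the pairs $(v,R(\{v\},L))$ of all the seeds $v$ selected so far, it either selects a next seed or stops. Write $\sigma(\pi)$ for the expected number of nodes that are reached, in $L$, from the seeds which $\pi$ has selected when it stops. Let $OPT_A(G,k)$ be the maximum of $\sigma(\pi)$ over all policies $\pi$ which, on every live-edge graph, stop after having selected exactly $k$ distinct seeds. If $k>|V|$, then in both problems the number of seeds is $|V|$ instead of $k$. The adaptivity gap of a class $\mathcal{G}$ of influence graphs is $$AG(\mathcal{G})=\sup_{k\ge 1}\,\sup_{G\in\mathcal{G}}\frac{OPT_A(G,k)}{OPT_N(G,k)}.$$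 Theorem. If $\mathcal{G}$ is the class of all influence graphs with at most $n$ nodes, then $AG(\mathcal{G})\le\lceil n^{1/3}\rceil$. -/

import Mathlib

universe u

/-- An influence graph `G = (V, E, (p_{uv})_{(u,v) ∈ E})`: a finite nonempty directed graph, each
edge of which carries an activation probability in `[0,1]`. The values of `prob` outside `edges`
are never used. -/
structure InfluenceGraph where
  V : Type u
  [fintypeV : Fintype V]
  [decEqV : DecidableEq V]
  [nonemptyV : Nonempty V]
  edges : Finset (V × V)
  prob : V × V → ℝ
  prob_mem : ∀ e ∈ edges, prob e ∈ Set.Icc (0 : ℝ) 1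

attribute [instance] InfluenceGraph.fintypeV InfluenceGraph.decEqV InfluenceGraph.nonemptyV

namespace InfluenceGraph

variable (G : InfluenceGraph.{u})

/-- The probability that the random live-edge graph has exactly the edge set `L ⊆ E`: every edge
`e` is live with probability `p_e`, independently of the other edges. -/
noncomputable def liveProb (L : Finset (G.V × G.V)) : ℝ :=
  (∏ e ∈ L, G.prob e) * ∏ e ∈ G.edges \ L, (1 - G.prob e)

/-- The expectation `𝔼_L[X(L)]` over the random live-edge graph `L`. -/
noncomputable def expect (X : Finset (G.V × G.V) → ℝ) : ℝ :=
  ∑ L ∈ G.edges.powerset, G.liveProb L * X L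

/-- `R(S, L)`: the nodes that are reachable by a path of live edges from some node of `S`. -/
noncomputable def reach (S : Finset G.V) (L : Finset (G.V × G.V)) : Finset G.V :=
  open Classical in
  Finset.univ.filter fun v => ∃ s ∈ S, Relation.ReflTransGen (fun a b => (a, b) ∈ L) s v

/-- The expected influence spread `σ(S) = 𝔼_L[|R(S, L)|]` of a seed set `S`. -/
noncomputable def spread (S : Finset G.V) : ℝ :=
  G.expect fun L => ((G.reach S L).card : ℝ)

/-- The number of seeds for the budget `k`: exactly `k` whenever `G` has at least `k` nodes, and
all the nodes of `G` otherwise. -/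
def budget (k : ℕ) : ℕ := min k (Fintype.card G.V)

/-- `OPT_N(G, k)`: the optimal value of the non-adaptive problem. -/
noncomputable def optN (k : ℕ) : ℝ :=
  sSup {x : ℝ | ∃ S : Finset G.V, S.card = G.budget k ∧ x = G.spread S}

/-- Full-adoption feedback: a partial realisation, represented by its set of pairs
`(v, R({v}, L))` with `v` in its domain (the nodes selected so far). -/
abbrev Feedback : Type u := Finset (G.V × Finset G.V)

variable {G}

/-- `dom(ψ)`. -/
def Feedback.dom (ψ : G.Feedback) : Finset G.V := ψ.image Prod.fst

/-- `R(ψ)`: the union of the sets `ψ(v)`, for `v ∈ dom(ψ)`. -/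
def Feedback.reached (ψ : G.Feedback) : Finset G.V := ψ.biUnion Prod.snd

variable (G)

/-- An adaptive policy maps the observed partial realisation to the next seed (`some v`), or
stops (`none`). -/
abbrev Policy : Type u := G.Feedback → Option G.V

variable {G}

namespace Policy

/-- One iteration of the loop which runs the policy `π` on the live-edge graph `L`: unless `π`
stops, the next seed `v` is activated and its whole spread `R({v}, L)` is observed. -/
noncomputable def step (π : G.Policy) (L : Finset (G.V × G.V)) (ψ : G.Feedback) : G.Feedback :=
  match π ψ with
  | none => ψ
  | some v => insert (v, G.reach {v} L) ψ

/-- The run of `π` on `L`, started from the empty partial realisation, stops after finitely many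
iterations and returns `ψ`. -/
def Returns (π : G.Policy) (L : Finset (G.V × G.V)) (ψ : G.Feedback) : Prop :=
  ∃ m : ℕ, (π.step L)^[m] ∅ = ψ ∧ π ψ = none

/-- `ψ_{π,L}`: the state of the run after `|V|` iterations. If the run of `π` on `L` stops, this is
the partial realisation which it returns, see `Returns.output_eq`. -/
noncomputable def output (π : G.Policy) (L : Finset (G.V × G.V)) : G.Feedback :=
  (π.step L)^[Fintype.card G.V] ∅

theorem subset_step (π : G.Policy) (L : Finset (G.V × G.V)) (ψ : G.Feedback) :
    ψ ⊆ π.step L ψ := by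
  unfold step
  split
  · exact Finset.Subset.refl _
  · exact Finset.subset_insert _ _

theorem card_iterate_le (π : G.Policy) (L : Finset (G.V × G.V)) (m : ℕ) :
    ((π.step L)^[m] ∅).card ≤ Fintype.card G.V := by
  have h : (π.step L)^[m] ∅ ⊆ Finset.univ.image fun v => (v, G.reach {v} L) := by
    induction m with
    | zero => simp
    | succ m ih =>
      rw [Function.iterate_succ_apply']
      generalize (π.step L)^[m] ∅ = ψ at ih ⊢
      unfold step
      split
      · exact ih
      · exact Finset.insert_subset (Finset.mem_image_of_mem _ (Finset.mem_univ _)) ih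
  exact (Finset.card_le_card h).trans Finset.card_image_le

theorem step_iterate_or (π : G.Policy) (L : Finset (G.V × G.V)) (m : ℕ) :
    m ≤ ((π.step L)^[m] ∅).card ∨ π.step L ((π.step L)^[m] ∅) = (π.step L)^[m] ∅ := by
  induction m with
  | zero => exact Or.inl (Nat.zero_le _)
  | succ m ih =>
    rw [Function.iterate_succ_apply']
    by_cases h : π.step L ((π.step L)^[m] ∅) = (π.step L)^[m] ∅
    · right; rw [h, h]
    · left
      have h1 := ih.resolve_right h
      have h2 := Finset.card_lt_card
        ((π.subset_step L ((π.step L)^[m] ∅)).ssubset_of_ne (Ne.symm h))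
      omega

theorem step_output (π : G.Policy) (L : Finset (G.V × G.V)) :
    π.step L (π.output L) = π.output L := by
  rcases π.step_iterate_or L (Fintype.card G.V) with h | h
  · have h1 := π.card_iterate_le L (Fintype.card G.V + 1)
    rw [Function.iterate_succ_apply'] at h1
    exact (Finset.eq_of_subset_of_card_le (π.subset_step L _) (h1.trans h)).symm
  · exact h

theorem Returns.output_eq {π : G.Policy} {L : Finset (G.V × G.V)} {ψ : G.Feedback}
    (h : π.Returns L ψ) : π.output L = ψ := by
  obtain ⟨m, rfl, h0⟩ := h
  have hfix : π.step L ((π.step L)^[m] ∅) = (π.step L)^[m] ∅ := by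
    generalize (π.step L)^[m] ∅ = ψ at h0 ⊢
    unfold step
    rw [h0]
  rcases le_total m (Fintype.card G.V) with hm | hm
  · obtain ⟨d, hd⟩ := Nat.exists_eq_add_of_le' hm
    unfold output
    rw [hd, Function.iterate_add_apply]
    exact Function.iterate_fixed hfix d
  · obtain ⟨d, rfl⟩ := Nat.exists_eq_add_of_le' hm
    rw [Function.iterate_add_apply]
    exact (Function.iterate_fixed (π.step_output L) d).symm

/-- `|π| = k`: on every live-edge graph the run of `π` stops, and it returns a partial realisation
with exactly `k` nodes in its domain. -/
def HasSize (π : G.Policy) (k : ℕ) : Prop :=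
  ∀ L ⊆ G.edges, ∃ ψ : G.Feedback, π.Returns L ψ ∧ ψ.dom.card = k

/-- The expected influence spread `σ(π) = 𝔼_L[|R(ψ_{π,L})|]` of an adaptive policy. -/
noncomputable def spread (π : G.Policy) : ℝ :=
  G.expect fun L => ((π.output L).reached.card : ℝ)

end Policy

variable (G)

/-- `OPT_A(G, k)`: the optimal value of the adaptive problem. -/
noncomputable def optA (k : ℕ) : ℝ :=
  sSup {x : ℝ | ∃ π : G.Policy, π.HasSize (G.budget k) ∧ x = π.spread}

end InfluenceGraph

/-- The `k`-adaptivity gap `AG(𝒢, k)` of a class `𝒢` of influence graphs, as a supremum in the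
extended reals. -/
noncomputable def adaptivityGapAt (𝒢 : Set InfluenceGraph.{u}) (k : ℕ) : EReal :=
  ⨆ G ∈ 𝒢, ((G.optA k / G.optN k : ℝ) : EReal)

/-- The adaptivity gap `AG(𝒢) = sup_{k ≥ 1} AG(𝒢, k)`. -/
noncomputable def adaptivityGap (𝒢 : Set InfluenceGraph.{u}) : EReal :=
  ⨆ (k : ℕ) (_ : 1 ≤ k), adaptivityGapAt 𝒢 k

/-- The class of influence graphs with at most `n` nodes. -/
def graphsOfSizeAtMost (n : ℕ) : Set InfluenceGraph.{u} :=
  {G | Fintype.card G.V ≤ n}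

/-! Write `n` for the number of nodes, `b` for the budget, `N` for `optN`, `s` for the largest
spread of a single node, and let `n ≤ m ^ 3`. The aim is `optA ≤ m * N`.

The probabilistic core is `Policy.spread_le`: for every fixed set `A`, a policy reaches on average
at most `σ(A)` plus the sum, over its seeds, of the expected spread along paths avoiding `A`. A
state `ψ` of the run only reveals edges leaving `R(ψ)`, so the spread of the next seed avoiding `A ∪
R(ψ)` is independent of what was observed. With `A = ∅` this gives `optA ≤ b * s`. With `A = R(S,
L)`, where `S` is an optimal seed set and `L` a copy independent of the run, each seed costs on
average at most a marginal gain over `S`, hence at most `N / b` by an exchange argument. Moreover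
`σ(A) ≤ |A| * N / b` whenever `|A| ≥ b`, so `E σ(R(S, L)) ≤ N * N / b`. Together, `optA ≤ N * (N +
b) / b` (`budget_mul_optA_le`).

Since `optA ≤ n`, only the case `m * N < n` matters, in which `N < m ^ 2`. If `b ≤ m`, then `b * s ≤
m * N`. If `b ≥ m + 2`, then `N + b ≤ m * b`. The remaining value `b = m + 1` barely escapes both
bounds; there `optA ≤ b * s` is combined with `card_sub_one_mul_le`, which forces `s` well below `N`
when `n` is large. -/

namespace InfluenceGraph

/-! ### Expectation over live-edge graphs, and independence of disjoint edge sets. -/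

section Expectation

variable {G : InfluenceGraph.{u}}

theorem liveProb_nonneg {L : Finset (G.V × G.V)} (hL : L ⊆ G.edges) : 0 ≤ G.liveProb L :=
  mul_nonneg (Finset.prod_nonneg fun e he => (G.prob_mem e (hL he)).1)
    (Finset.prod_nonneg fun e he =>
      sub_nonneg.2 (G.prob_mem e (Finset.mem_sdiff.1 he).1).2)

theorem sum_liveProb (G : InfluenceGraph.{u}) : ∑ L ∈ G.edges.powerset, G.liveProb L = 1 := by
  unfold liveProb
  rw [← Finset.prod_add]
  simp

theorem expect_const (G : InfluenceGraph.{u}) (c : ℝ) : G.expect (fun _ => c) = c := by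
  unfold expect
  rw [← Finset.sum_mul, sum_liveProb, one_mul]

theorem expect_mono {X Y : Finset (G.V × G.V) → ℝ} (h : ∀ L ⊆ G.edges, X L ≤ Y L) :
    G.expect X ≤ G.expect Y :=
  Finset.sum_le_sum fun L hL =>
    mul_le_mul_of_nonneg_left (h L (Finset.mem_powerset.1 hL))
      (liveProb_nonneg (Finset.mem_powerset.1 hL))

theorem expect_congr {X Y : Finset (G.V × G.V) → ℝ} (h : ∀ L ⊆ G.edges, X L = Y L) :
    G.expect X = G.expect Y :=
  le_antisymm (expect_mono fun L hL => (h L hL).le) (expect_mono fun L hL => (h L hL).ge)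

theorem expect_nonneg {X : Finset (G.V × G.V) → ℝ} (h : ∀ L ⊆ G.edges, 0 ≤ X L) :
    0 ≤ G.expect X := by
  rw [← expect_const G 0]
  exact expect_mono h

theorem expect_add (X Y : Finset (G.V × G.V) → ℝ) :
    G.expect (fun L => X L + Y L) = G.expect X + G.expect Y := by
  simp only [expect, mul_add, Finset.sum_add_distrib]

theorem expect_sub (X Y : Finset (G.V × G.V) → ℝ) :
    G.expect (fun L => X L - Y L) = G.expect X - G.expect Y := by
  simp only [expect, mul_sub, Finset.sum_sub_distrib]

theorem expect_const_mul (c : ℝ) (X : Finset (G.V × G.V) → ℝ) :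
    G.expect (fun L => c * X L) = c * G.expect X := by
  simp only [expect, Finset.mul_sum, mul_left_comm]

theorem expect_mul_const (c : ℝ) (X : Finset (G.V × G.V) → ℝ) :
    G.expect (fun L => X L * c) = G.expect X * c := by
  simp only [mul_comm _ c, expect_const_mul]

theorem expect_sum {ι : Type*} (s : Finset ι) (X : ι → Finset (G.V × G.V) → ℝ) :
    G.expect (fun L => ∑ i ∈ s, X i L) = ∑ i ∈ s, G.expect (X i) := by
  simp only [expect, Finset.mul_sum]
  exact Finset.sum_comm

theorem expect_comm (X : Finset (G.V × G.V) → Finset (G.V × G.V) → ℝ) :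
    G.expect (fun L => G.expect (X L)) = G.expect (fun L' => G.expect fun L => X L L') := by
  simp only [expect, Finset.mul_sum]
  rw [Finset.sum_comm]
  exact Finset.sum_congr rfl fun _ _ => Finset.sum_congr rfl fun _ _ => mul_left_comm _ _ _

/-- Functions of two disjoint sets of edges, separated by the predicate `P`, are independent. -/
theorem expect_mul_of_dependsOn_filter (P : G.V × G.V → Prop) [DecidablePred P]
    {X Y : Finset (G.V × G.V) → ℝ}
    (hX : ∀ L ⊆ G.edges, X L = X (L.filter P))
    (hY : ∀ L ⊆ G.edges, Y L = Y (L.filter fun e => ¬ P e)) :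
    G.expect (fun L => X L * Y L) = G.expect X * G.expect Y := by
  set E₁ := G.edges.filter P
  set E₂ := G.edges.filter fun e => ¬ P e
  let w : Finset (G.V × G.V) → Finset (G.V × G.V) → ℝ := fun E L =>
    (∏ e ∈ L, G.prob e) * ∏ e ∈ E \ L, (1 - G.prob e)
  have hw : ∀ E, ∑ L ∈ E.powerset, w E L = 1 := fun E => by
    simp only [w]
    rw [← Finset.prod_add]
    simp
  -- The live-edge law is a product law: `L` splits into its parts inside and outside `P`, with
  -- weights `w E₁` and `w E₂`.
  have hsplit : ∀ Z : Finset (G.V × G.V) → Finset (G.V × G.V) → ℝ,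
      G.expect (fun L => Z (L.filter P) (L.filter fun e => ¬ P e)) =
        ∑ L₁ ∈ E₁.powerset, ∑ L₂ ∈ E₂.powerset, w E₁ L₁ * w E₂ L₂ * Z L₁ L₂ := by
    intro Z
    unfold expect
    rw [← Finset.sum_product']
    refine Finset.sum_nbij' (fun L => (L.filter P, L.filter fun e => ¬ P e))
      (fun q => q.1 ∪ q.2) ?_ ?_ ?_ ?_ ?_
    · intro L hL
      rw [Finset.mem_powerset] at hL
      simp only [Finset.mem_product, Finset.mem_powerset]
      exact ⟨Finset.filter_subset_filter _ hL, Finset.filter_subset_filter _ hL⟩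
    · rintro ⟨L₁, L₂⟩ h
      simp only [Finset.mem_product, Finset.mem_powerset] at h ⊢
      exact Finset.union_subset (h.1.trans (Finset.filter_subset _ _))
        (h.2.trans (Finset.filter_subset _ _))
    · intro L _
      exact Finset.filter_union_filter_not_eq P L
    · rintro ⟨L₁, L₂⟩ h
      simp only [Finset.mem_product, Finset.mem_powerset] at h
      have h1 : ∀ e ∈ L₁, P e := fun e he => (Finset.mem_filter.1 (h.1 he)).2
      have h2 : ∀ e ∈ L₂, ¬ P e := fun e he => (Finset.mem_filter.1 (h.2 he)).2
      ext e <;> simp only [Finset.mem_filter, Finset.mem_union]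
      · exact ⟨fun ⟨a, b⟩ => a.resolve_right fun c => h2 e c b, fun a => ⟨Or.inl a, h1 e a⟩⟩
      · exact ⟨fun ⟨a, b⟩ => a.resolve_left fun c => b (h1 e c), fun a => ⟨Or.inr a, h2 e a⟩⟩
    · intro L _
      congr 1
      simp only [liveProb, w]
      have hs : ∀ (Q : G.V × G.V → Prop) [DecidablePred Q],
          G.edges.filter Q \ L.filter Q = (G.edges \ L).filter Q := by
        intro Q _
        ext e
        simp only [Finset.mem_sdiff, Finset.mem_filter]
        tauto
      rw [hs P, hs fun e => ¬ P e, ← Finset.prod_filter_mul_prod_filter_not L P,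
        ← Finset.prod_filter_mul_prod_filter_not (G.edges \ L) P]
      ring
  have h1 := hsplit fun L₁ L₂ => X L₁ * Y L₂
  have h2 := hsplit fun L₁ _ => X L₁
  have h3 := hsplit fun _ L₂ => Y L₂
  rw [expect_congr (fun L hL => by rw [hX L hL, hY L hL] : ∀ L ⊆ G.edges, X L * Y L = _),
    expect_congr hX, expect_congr hY, h1, h2, h3]
  have h4 : ∑ L₁ ∈ E₁.powerset, ∑ L₂ ∈ E₂.powerset, w E₁ L₁ * w E₂ L₂ * X L₁ =
      ∑ L₁ ∈ E₁.powerset, w E₁ L₁ * X L₁ := by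
    refine Finset.sum_congr rfl fun L₁ _ => ?_
    rw [← Finset.sum_mul, ← Finset.mul_sum, hw, mul_one]
  have h5 : ∑ L₁ ∈ E₁.powerset, ∑ L₂ ∈ E₂.powerset, w E₁ L₁ * w E₂ L₂ * Y L₂ =
      ∑ L₂ ∈ E₂.powerset, w E₂ L₂ * Y L₂ := by
    simp only [mul_assoc, ← Finset.mul_sum]
    rw [← Finset.sum_mul, hw, one_mul]
  rw [h4, h5, Finset.sum_mul_sum]
  refine Finset.sum_congr rfl fun L₁ _ => Finset.sum_congr rfl fun L₂ _ => ?_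
  ring

end Expectation

/-! ### Reachability, and spread along paths that avoid a set. -/

section Reach

variable {G : InfluenceGraph.{u}}

theorem mem_reach {S : Finset G.V} {L : Finset (G.V × G.V)} {v : G.V} :
    v ∈ G.reach S L ↔ ∃ s ∈ S, Relation.ReflTransGen (fun a b => (a, b) ∈ L) s v := by
  simp [reach]

theorem mem_reach_singleton {u v : G.V} {L : Finset (G.V × G.V)} :
    v ∈ G.reach {u} L ↔ Relation.ReflTransGen (fun a b => (a, b) ∈ L) u v := by
  simp [reach]

theorem reach_eq_biUnion (S : Finset G.V) (L : Finset (G.V × G.V)) :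
    G.reach S L = S.biUnion fun v => G.reach {v} L := by
  ext v
  simp [reach]

theorem subset_reach (S : Finset G.V) (L : Finset (G.V × G.V)) : S ⊆ G.reach S L :=
  fun v hv => mem_reach.2 ⟨v, hv, .refl⟩

theorem reach_mono_left {S T : Finset G.V} (h : S ⊆ T) (L : Finset (G.V × G.V)) :
    G.reach S L ⊆ G.reach T L := fun v hv => by
  obtain ⟨s, hs, hsv⟩ := mem_reach.1 hv
  exact mem_reach.2 ⟨s, h hs, hsv⟩

theorem reach_mono_right (S : Finset G.V) {L L' : Finset (G.V × G.V)} (h : L ⊆ L') :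
    G.reach S L ⊆ G.reach S L' := fun v hv => by
  obtain ⟨s, hs, hsv⟩ := mem_reach.1 hv
  exact mem_reach.2 ⟨s, hs, Relation.ReflTransGen.mono (fun _ _ hab => h hab) _ _ hsv⟩

theorem mem_reach_of_mem {S : Finset G.V} {L : Finset (G.V × G.V)} {u v : G.V}
    (hu : u ∈ G.reach S L) (h : Relation.ReflTransGen (fun a b => (a, b) ∈ L) u v) :
    v ∈ G.reach S L := by
  obtain ⟨s, hs, hsu⟩ := mem_reach.1 hu
  exact mem_reach.2 ⟨s, hs, hsu.trans h⟩

/-- `R(S, L)` only depends on the live edges which leave it. -/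
theorem reach_eq_of_agree {S B : Finset G.V} {L L' : Finset (G.V × G.V)}
    (hB : G.reach S L ⊆ B)
    (h : L.filter (fun e => e.1 ∈ B) = L'.filter fun e => e.1 ∈ B) :
    G.reach S L' = G.reach S L := by
  have h' : ∀ a ∈ B, ∀ b, (a, b) ∈ L ↔ (a, b) ∈ L' := by
    intro a ha b
    have := Finset.ext_iff.1 h (a, b)
    simpa [ha] using this
  ext v
  constructor
  · intro hv
    obtain ⟨s, hs, hsv⟩ := mem_reach.1 hv
    have hs' := subset_reach S L hs
    clear hv
    induction hsv with
    | refl => exact hs'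
    | tail _ hbc ih =>
      exact mem_reach_of_mem ih (.single ((h' _ (hB ih) _).2 hbc))
  · intro hv
    obtain ⟨s, hs, hsv⟩ := mem_reach.1 hv
    clear hv
    refine mem_reach.2 ⟨s, hs, ?_⟩
    induction hsv with
    | refl => exact .refl
    | tail hab hbc ih =>
      exact ih.tail ((h' _ (hB (mem_reach.2 ⟨s, hs, hab⟩)) _).1 hbc)

/-- The nodes which are reachable from `v` along live paths that avoid `A`. -/
noncomputable def reachAvoiding (v : G.V) (A : Finset G.V) (L : Finset (G.V × G.V)) :
    Finset G.V :=
  G.reach {v} (L.filter fun e => e.1 ∉ A) \ A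

theorem reachAvoiding_anti (v : G.V) {A B : Finset G.V} (h : A ⊆ B) (L : Finset (G.V × G.V)) :
    reachAvoiding v B L ⊆ reachAvoiding v A L :=
  Finset.sdiff_subset_sdiff
    (reach_mono_right _ (Finset.monotone_filter_right _ fun _ _ he ha => he (h ha))) h

theorem reachAvoiding_subset (v : G.V) (A : Finset G.V) (L : Finset (G.V × G.V)) :
    reachAvoiding v A L ⊆ G.reach {v} L \ A :=
  Finset.sdiff_subset_sdiff (reach_mono_right _ (Finset.filter_subset _ _)) subset_rfl

theorem reachAvoiding_filter (v : G.V) {A B : Finset G.V} (h : B ⊆ A)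
    (L : Finset (G.V × G.V)) :
    reachAvoiding v A (L.filter fun e => ¬ e.1 ∈ B) = reachAvoiding v A L := by
  unfold reachAvoiding
  rw [Finset.filter_filter]
  congr 3
  ext e
  exact ⟨fun a => a.2, fun a => ⟨fun b => a (h b), a⟩⟩

/-- A live path that meets `A` ends in `C`, since `C` contains everything reachable from `A`. So a
path ending outside `C` uses no edge leaving `A`. -/
theorem reach_sdiff_subset_reachAvoiding {v : G.V} {A C : Finset G.V} {L : Finset (G.V × G.V)}
    (hAC : A ⊆ C) (hC : ∀ a ∈ A, ∀ b, Relation.ReflTransGen (fun a b => (a, b) ∈ L) a b → b ∈ C) :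
    G.reach {v} L \ C ⊆ reachAvoiding v A L := by
  intro w hw
  rw [Finset.mem_sdiff, mem_reach_singleton] at hw
  obtain ⟨hvw, hwC⟩ := hw
  refine Finset.mem_sdiff.2 ⟨mem_reach_singleton.2 ?_, fun h => hwC (hAC h)⟩
  induction hvw using Relation.ReflTransGen.head_induction_on with
  | refl => exact .refl
  | head hab hbc ih =>
    exact ih.head (Finset.mem_filter.2 ⟨hab, fun ha => hwC (hC _ ha _ (hbc.head hab))⟩)

/-- The expected number of nodes reachable from `v` along live paths that avoid `A`. -/
noncomputable def spreadAvoiding (v : G.V) (A : Finset G.V) : ℝ :=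
  G.expect fun L => ((reachAvoiding v A L).card : ℝ)

theorem spreadAvoiding_anti (v : G.V) {A B : Finset G.V} (h : A ⊆ B) :
    spreadAvoiding v B ≤ spreadAvoiding v A :=
  expect_mono fun L _ => Nat.cast_le.2 (Finset.card_le_card (reachAvoiding_anti v h L))

theorem spreadAvoiding_empty (v : G.V) : spreadAvoiding v ∅ ≤ G.spread {v} :=
  expect_mono fun L _ => Nat.cast_le.2
    (Finset.card_le_card ((reachAvoiding_subset v ∅ L).trans Finset.sdiff_subset))

/-- An event that only depends on the edges leaving `B` is independent of the spread that
avoids `A ⊇ B`. -/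
theorem expect_indicator_mul_reachAvoiding (p : Finset (G.V × G.V) → Prop) [DecidablePred p]
    {A B : Finset G.V} (hBA : B ⊆ A) (v : G.V)
    (hp : ∀ L L' : Finset (G.V × G.V),
      L.filter (fun e => e.1 ∈ B) = L'.filter (fun e => e.1 ∈ B) → p L → p L') :
    G.expect (fun L => (if p L then (1 : ℝ) else 0) * ((reachAvoiding v A L).card : ℝ)) =
      G.expect (fun L => if p L then (1 : ℝ) else 0) * spreadAvoiding v A := by
  refine expect_mul_of_dependsOn_filter (fun e => e.1 ∈ B) (fun L _ => ?_) (fun L _ => ?_)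
  · have h : L.filter (fun e => e.1 ∈ B) =
        (L.filter fun e => e.1 ∈ B).filter (fun e => e.1 ∈ B) := by
      rw [Finset.filter_filter]
      simp only [and_self]
    have : p L ↔ p (L.filter fun e => e.1 ∈ B) := ⟨hp _ _ h, hp _ _ h.symm⟩
    simp only [this]
  · rw [reachAvoiding_filter v hBA]

/-- Averaging over an independent copy of `R(S, L)` bounds the avoiding spread by the marginal
gain. -/
theorem expect_spreadAvoiding_reach_le (v : G.V) (S : Finset G.V) :
    G.expect (fun L => spreadAvoiding v (G.reach S L)) ≤
      G.spread (insert v S) - G.spread S := by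
  classical
  -- Condition on the value `A` of `R(S, L)`.
  have h1 : ∀ F : Finset (G.V × G.V) → Finset G.V → ℝ,
      G.expect (fun L => F L (G.reach S L)) =
        ∑ A : Finset G.V, G.expect (fun L => (if G.reach S L = A then (1 : ℝ) else 0) * F L A) := by
    intro F
    rw [← expect_sum]
    exact expect_congr fun L _ => by simp
  rw [h1 fun _ A => spreadAvoiding v A]
  have h2 : G.expect (fun L => ((reachAvoiding v (G.reach S L) L).card : ℝ)) ≤
      G.spread (insert v S) - G.spread S := by
    unfold spread
    rw [← expect_sub]
    refine expect_mono fun L _ => ?_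
    have hi : G.reach (insert v S) L = G.reach {v} L ∪ G.reach S L := by
      rw [reach_eq_biUnion (insert v S), Finset.biUnion_insert, ← reach_eq_biUnion]
    rw [hi, ← Finset.card_sdiff_add_card]
    push_cast
    rw [add_sub_cancel_right]
    exact Nat.cast_le.2 (Finset.card_le_card (reachAvoiding_subset v _ L))
  refine le_of_eq_of_le ?_ h2
  rw [h1 fun L A => ((reachAvoiding v A L).card : ℝ)]
  refine Finset.sum_congr rfl fun A _ => ?_
  -- The event `R(S, L) = A` is decided by edges leaving `A`, which the spread avoiding `A` never
  -- uses. So the independent copy may be replaced by the same `L`.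
  rw [expect_mul_const, expect_indicator_mul_reachAvoiding (fun L => G.reach S L = A)
    (subset_refl A) v]
  rintro L L' h rfl
  exact reach_eq_of_agree subset_rfl h

end Reach

end InfluenceGraph

namespace InfluenceGraph

/-! ### Runs of a policy, and bounds on its expected spread. -/

section Policy

variable {G : InfluenceGraph.{u}}

namespace Policy

theorem mem_iterate_step {π : G.Policy} {L : Finset (G.V × G.V)} {i : ℕ}
    {q : G.V × Finset G.V} (hq : q ∈ (π.step L)^[i] ∅) : q.2 = G.reach {q.1} L := by
  induction i with
  | zero => simp at hq
  | succ i ih =>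
    rw [Function.iterate_succ_apply'] at hq
    generalize (π.step L)^[i] ∅ = ψ at ih hq
    unfold step at hq
    split at hq
    · exact ih hq
    · rcases Finset.mem_insert.1 hq with rfl | h
      · rfl
      · exact ih h

theorem reached_iterate_step (π : G.Policy) (L : Finset (G.V × G.V)) (i : ℕ) :
    Feedback.reached ((π.step L)^[i] ∅) = G.reach (Feedback.dom ((π.step L)^[i] ∅)) L := by
  rw [reach_eq_biUnion, Feedback.reached, Feedback.dom, Finset.image_biUnion]
  exact Finset.biUnion_congr rfl fun q hq => mem_iterate_step hq

/-- The state `ψ` of a run only depends on the live edges which leave `R(ψ)`. -/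
theorem iterate_step_eq_of_agree (π : G.Policy) {L L' : Finset (G.V × G.V)} (i : ℕ)
    {B : Finset G.V} (hB : Feedback.reached ((π.step L)^[i] ∅) ⊆ B)
    (h : L.filter (fun e => e.1 ∈ B) = L'.filter fun e => e.1 ∈ B) :
    (π.step L')^[i] ∅ = (π.step L)^[i] ∅ := by
  induction i with
  | zero => rfl
  | succ i ih =>
    simp only [Function.iterate_succ_apply'] at hB ⊢
    have h0 : Feedback.reached ((π.step L)^[i] ∅) ⊆ B :=
      (Finset.biUnion_subset_biUnion_of_subset_left _ (π.subset_step L _)).trans hB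
    rw [ih h0]
    generalize (π.step L)^[i] ∅ = ψ at hB
    unfold step at hB ⊢
    split
    · rfl
    · rename_i v hv
      simp only [hv, Feedback.reached, Finset.biUnion_insert] at hB
      rw [reach_eq_of_agree (Finset.union_subset_left hB) h]

/-- The total avoiding spread of the seeds selected in the state `ψ`. -/
noncomputable def domSpread (A : Finset G.V) (ψ : G.Feedback) : ℝ :=
  ∑ v ∈ ψ.dom, spreadAvoiding v A

/-- In every single step, the expected number of new nodes outside `R(A, L)` is at most the
expected avoiding spread of the new seed. -/
theorem expect_card_step_le (π : G.Policy) (A : Finset G.V) (i : ℕ) :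
    G.expect (fun L => (((π.step L)^[i + 1] ∅ : G.Feedback).reached \ G.reach A L).card) -
        G.expect (fun L => (((π.step L)^[i] ∅ : G.Feedback).reached \ G.reach A L).card) ≤
      G.expect (fun L => domSpread A ((π.step L)^[i + 1] ∅)) -
        G.expect (fun L => domSpread A ((π.step L)^[i] ∅)) := by
  classical
  let ρ : Finset (G.V × G.V) → G.Feedback := fun L => (π.step L)^[i] ∅
  -- `X` dominates the number of new nodes, and `Y` is the increase of `domSpread`. Both vanish when
  -- a seed is selected again, because its pair already belongs to the state.
  let X : Finset (G.V × G.V) → G.Feedback → ℝ := fun L ψ =>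
    match π ψ with
    | none => 0
    | some v => if v ∈ ψ.dom then 0 else ((reachAvoiding v (A ∪ ψ.reached) L).card : ℝ)
  let Y : G.Feedback → ℝ := fun ψ =>
    match π ψ with
    | none => 0
    | some v => if v ∈ ψ.dom then 0 else spreadAvoiding v A
  have hsum : ∀ F : Finset (G.V × G.V) → G.Feedback → ℝ,
      G.expect (fun L => F L (ρ L)) =
        ∑ ψ : G.Feedback, G.expect (fun L => (if ρ L = ψ then (1 : ℝ) else 0) * F L ψ) := by
    intro F
    rw [← expect_sum]
    exact expect_congr fun L _ => by simp
  have hXY : G.expect (fun L => X L (ρ L)) ≤ G.expect fun L => Y (ρ L) := by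
    rw [hsum X, hsum fun _ ψ => Y ψ]
    refine Finset.sum_le_sum fun ψ _ => ?_
    rw [expect_mul_const]
    simp only [X, Y]
    split
    · simp [expect]
    · rename_i v _
      split_ifs
      · simp [expect]
      · rw [expect_indicator_mul_reachAvoiding (fun L => ρ L = ψ)
          (Finset.subset_union_right : ψ.reached ⊆ A ∪ ψ.reached) v]
        -- Once independence has separated the two factors, `R(ψ)` can be dropped from the avoided
        -- set.
        · exact mul_le_mul_of_nonneg_left (spreadAvoiding_anti v Finset.subset_union_left)
            (expect_nonneg fun L _ => by split_ifs <;> simp)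
        · rintro L L' h rfl
          exact iterate_step_eq_of_agree π i subset_rfl h
  rw [← expect_sub, ← expect_sub]
  refine (expect_mono fun L _ => ?_).trans (hXY.trans (expect_mono fun L _ => ?_))
  · have hmem : ∀ q ∈ ρ L, q.2 = G.reach {q.1} L := fun q hq => mem_iterate_step hq
    have hreach : (ρ L).reached = G.reach (ρ L).dom L := reached_iterate_step π L i
    rw [Function.iterate_succ_apply']
    change ((Feedback.reached (π.step L (ρ L)) \ G.reach A L).card : ℝ) -
      ((ρ L).reached \ G.reach A L).card ≤ X L (ρ L)
    generalize ρ L = ψ at hmem hreach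
    rcases hπ : π ψ with _ | v <;> simp only [X, step, hπ]
    · simp
    · split_ifs with hv
      · obtain ⟨q, hq, rfl⟩ := Finset.mem_image.1 hv
        rw [Finset.insert_eq_of_mem (by rw [← hmem q hq]; exact hq), sub_self]
      · have hr : Feedback.reached (insert (v, G.reach {v} L) ψ) = G.reach {v} L ∪ ψ.reached := by
          simp [Feedback.reached, Finset.biUnion_insert]
        have hsub : Feedback.reached (insert (v, G.reach {v} L) ψ) \ G.reach A L ⊆
            reachAvoiding v (A ∪ ψ.reached) L ∪ ψ.reached \ G.reach A L := by
          have h1 : G.reach {v} L \ (G.reach A L ∪ ψ.reached) ⊆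
              reachAvoiding v (A ∪ ψ.reached) L := by
            -- `R(A, L) ∪ R(ψ)` is closed under live reachability, `R(ψ)` being the reach of the
            -- seeds.
            refine reach_sdiff_subset_reachAvoiding
              (Finset.union_subset_union_left (subset_reach A L)) fun a ha b hab => ?_
            rcases Finset.mem_union.1 ha with h | h
            · exact Finset.mem_union_left _ (mem_reach.2 ⟨a, h, hab⟩)
            · rw [hreach] at h ⊢
              exact Finset.mem_union_right _ (mem_reach_of_mem h hab)
          rw [hr]
          intro w hw
          simp only [Finset.mem_sdiff, Finset.mem_union] at hw ⊢
          by_cases hwψ : w ∈ ψ.reached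
          · exact Or.inr ⟨hwψ, hw.2⟩
          · refine Or.inl (h1 ?_)
            simp only [Finset.mem_sdiff, Finset.mem_union]
            tauto
        have := (Finset.card_le_card hsub).trans (Finset.card_union_le _ _)
        rw [sub_le_iff_le_add]
        exact_mod_cast this
  · rw [Function.iterate_succ_apply']
    change Y (ρ L) ≤ domSpread A (π.step L (ρ L)) - domSpread A (ρ L)
    generalize ρ L = ψ
    rcases hπ : π ψ with _ | v <;> simp only [Y, step, hπ]
    · simp
    · have hd : Feedback.dom (insert (v, G.reach {v} L) ψ) = insert v ψ.dom := by
        simp [Feedback.dom, Finset.image_insert]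
      unfold domSpread
      rw [hd]
      split_ifs with hv
      · rw [Finset.insert_eq_of_mem hv, sub_self]
      · rw [Finset.sum_insert hv, add_sub_cancel_right]

/-- Telescoping `expect_card_step_le` bounds the nodes reached outside `R(A, L)`; those inside
number `σ(A)` on average at most. -/
theorem spread_le (π : G.Policy) (A : Finset G.V) :
    π.spread ≤ G.spread A + G.expect fun L => domSpread A (π.output L) := by
  have h : ∀ i : ℕ,
      G.expect (fun L => (((π.step L)^[i] ∅ : G.Feedback).reached \ G.reach A L).card) ≤
        G.expect (fun L => domSpread A ((π.step L)^[i] ∅)) := by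
    intro i
    induction i with
    | zero => simp [Feedback.reached, domSpread, Feedback.dom]
    | succ i ih => linarith [expect_card_step_le π A i]
  refine le_trans ?_ (add_le_add_right (h (Fintype.card G.V)) _)
  unfold spread InfluenceGraph.spread
  rw [← expect_add]
  refine expect_mono fun L _ => ?_
  have := Finset.card_le_card_sdiff_add_card (t := G.reach A L) (s := (π.output L).reached)
  rw [add_comm]
  exact_mod_cast this

theorem HasSize.card_dom_output {π : G.Policy} {k : ℕ} (h : π.HasSize k)
    {L : Finset (G.V × G.V)} (hL : L ⊆ G.edges) : (π.output L).dom.card = k := by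
  obtain ⟨ψ, hψ, hk⟩ := h L hL
  rw [hψ.output_eq, hk]

theorem HasSize.spread_le_mul {π : G.Policy} {k : ℕ} (h : π.HasSize k) {s : ℝ}
    (hs : ∀ v, G.spread {v} ≤ s) : π.spread ≤ k * s := by
  have h0 : G.spread ∅ = 0 := by simp [InfluenceGraph.spread, reach, expect]
  refine (π.spread_le ∅).trans ?_
  rw [h0, zero_add, ← expect_const G (k * s)]
  refine expect_mono fun L hL => ?_
  rw [← h.card_dom_output hL, ← nsmul_eq_mul]
  exact Finset.sum_le_card_nsmul _ _ _ fun v _ => (spreadAvoiding_empty v).trans (hs v)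

/-- `spread_le` holds for every fixed `A`, so it may be averaged over `A = R(S, L)` with `L`
independent of the run. After exchanging the expectations, each seed of the run is a fixed node with
respect to this `L`, and `expect_spreadAvoiding_reach_le` applies. -/
theorem HasSize.spread_le_expect {π : G.Policy} {k : ℕ} (h : π.HasSize k) {S : Finset G.V}
    {d : ℝ} (hd : ∀ v, G.spread (insert v S) - G.spread S ≤ d) :
    π.spread ≤ G.expect (fun L => G.spread (G.reach S L)) + k * d := by
  rw [← expect_const G π.spread]
  refine (expect_mono fun L _ => π.spread_le (G.reach S L)).trans ?_
  rw [expect_add, expect_comm]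
  refine add_le_add_right ?_ _
  rw [← expect_const G (k * d)]
  refine expect_mono fun L hL => ?_
  simp only [domSpread]
  rw [expect_sum, ← h.card_dom_output hL, ← nsmul_eq_mul]
  exact Finset.sum_le_card_nsmul _ _ _ fun v _ =>
    (expect_spreadAvoiding_reach_le v S).trans (hd v)

theorem spread_le_card (π : G.Policy) : π.spread ≤ Fintype.card G.V := by
  rw [← expect_const G (Fintype.card G.V : ℝ)]
  exact expect_mono fun L _ => Nat.cast_le.2 (Finset.card_le_univ _)

end Policy

end Policy

end InfluenceGraph

/-! ### Averaging over deletions from a set. -/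

/-- The private parts of the members of a union are disjoint, so their sizes sum to at most the
size of the union. -/
theorem Finset.sum_card_biUnion_sub_erase_le {ι α : Type*} [DecidableEq ι] [DecidableEq α]
    (A : Finset ι) (g : ι → Finset α) :
    ∑ a ∈ A, (((A.biUnion g).card : ℝ) - ((A.erase a).biUnion g).card) ≤ (A.biUnion g).card := by
  have h1 : ∀ a ∈ A, ((A.biUnion g).card : ℝ) - ((A.erase a).biUnion g).card =
      (A.biUnion g \ (A.erase a).biUnion g).card := by
    intro a _
    rw [Finset.cast_card_sdiff
      (Finset.biUnion_subset_biUnion_of_subset_left _ (Finset.erase_subset a A))]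
  rw [Finset.sum_congr rfl h1, ← Nat.cast_sum, Nat.cast_le, ← Finset.card_biUnion]
  · refine Finset.card_le_card (Finset.biUnion_subset.2 fun a _ => Finset.sdiff_subset)
  · intro a _ b _ hab
    rw [Function.onFun, Finset.disjoint_left]
    intro w ha hb
    simp only [Finset.mem_sdiff, Finset.mem_biUnion, Finset.mem_erase, not_exists, not_and]
      at ha hb
    obtain ⟨⟨c, hc, hw⟩, ha'⟩ := ha
    by_cases hca : c = a
    · subst hca
      exact hb.2 c ⟨hab, hc⟩ hw
    · exact ha' c ⟨hca, hc⟩ hw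

/-- The losses over all deletions sum to at most `f A`, so some deletion loses at most `f A / |A|`.
-/
theorem Finset.exists_erase_mul_le {ι : Type*} [DecidableEq ι] {f : Finset ι → ℝ} {A : Finset ι}
    (hA : A.Nonempty) (hf : ∑ a ∈ A, (f A - f (A.erase a)) ≤ f A) :
    ∃ a ∈ A, (A.card - 1 : ℝ) * f A ≤ A.card * f (A.erase a) := by
  by_contra! h
  have h1 := Finset.sum_lt_sum_of_nonempty hA h
  have hc : (0 : ℝ) < A.card := by exact_mod_cast hA.card_pos
  rw [← Finset.mul_sum, Finset.sum_const, nsmul_eq_mul] at h1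
  have h2 := lt_of_mul_lt_mul_left h1 hc.le
  rw [Finset.sum_sub_distrib, Finset.sum_const, nsmul_eq_mul] at hf
  linarith

/-- If removing a random element loses on average at most its share, then some `k`-subset of `A`
has at least the fraction `k / |A|` of the value of `A`. -/
theorem Finset.exists_subset_card_eq_mul_le {ι : Type*} [DecidableEq ι] {f : Finset ι → ℝ}
    (hf : ∀ A : Finset ι, ∑ a ∈ A, (f A - f (A.erase a)) ≤ f A) {k : ℕ} (A : Finset ι)
    (hk : k ≤ A.card) : ∃ T ⊆ A, T.card = k ∧ k * f A ≤ A.card * f T := by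
  induction A using Finset.strongInduction with
  | H A ih =>
    rcases hk.eq_or_lt with rfl | hlt
    · exact ⟨A, subset_rfl, rfl, le_rfl⟩
    have hA : A.Nonempty := Finset.card_pos.1 (by omega)
    obtain ⟨a, ha, h⟩ := Finset.exists_erase_mul_le hA (hf A)
    have hc := Finset.card_erase_add_one ha
    obtain ⟨T, hT, hTk, hle⟩ := ih _ (Finset.erase_ssubset ha) (by omega)
    refine ⟨T, hT.trans (Finset.erase_subset a A), hTk, ?_⟩
    have hc' : ((A.erase a).card : ℝ) = A.card - 1 := by
      rw [← hc]; push_cast; ring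
    rw [hc'] at hle
    -- For `k = 0` the factor `|A| - 1` may vanish and cannot be cancelled; there `f ∅ ≥ 0`, which
    -- is `hf ∅`, suffices.
    rcases Nat.eq_zero_or_pos k with rfl | hkpos
    · have hT0 : T = ∅ := Finset.card_eq_zero.1 hTk
      have := hf ∅
      rw [Finset.sum_empty] at this
      rw [hT0, Nat.cast_zero, zero_mul]
      positivity
    · have hc1 : (0 : ℝ) < A.card - 1 := by
        have : (2 : ℝ) ≤ A.card := by exact_mod_cast (by omega : 2 ≤ A.card)
        linarith
      refine le_of_mul_le_mul_left ?_ hc1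
      calc (A.card - 1 : ℝ) * (k * f A) = k * ((A.card - 1) * f A) := by ring
        _ ≤ k * (A.card * f (A.erase a)) := by gcongr
        _ = A.card * (k * f (A.erase a)) := by ring
        _ ≤ A.card * ((A.card - 1) * f T) := by gcongr
        _ = _ := by ring

/-! ### Bounds on the two optima. -/

namespace InfluenceGraph

variable {G : InfluenceGraph.{u}}

theorem sum_expect_card_biUnion_sub_erase_le
    (g : Finset (G.V × G.V) → G.V → Finset G.V) (A : Finset G.V) :
    ∑ a ∈ A, (G.expect (fun L => ((A.biUnion (g L)).card : ℝ)) -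
      G.expect (fun L => (((A.erase a).biUnion (g L)).card : ℝ))) ≤
        G.expect fun L => ((A.biUnion (g L)).card : ℝ) := by
  simp only [← expect_sub]
  rw [← expect_sum]
  exact expect_mono fun L _ => Finset.sum_card_biUnion_sub_erase_le A (g L)

theorem sum_spread_sub_erase_le (A : Finset G.V) :
    ∑ a ∈ A, (G.spread A - G.spread (A.erase a)) ≤ G.spread A := by
  simpa only [← reach_eq_biUnion, ← spread.eq_def] using
    sum_expect_card_biUnion_sub_erase_le (fun L a => G.reach {a} L) A

theorem spread_mono {S T : Finset G.V} (h : S ⊆ T) : G.spread S ≤ G.spread T :=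
  expect_mono fun L _ => Nat.cast_le.2 (Finset.card_le_card (reach_mono_left h L))

theorem card_le_spread (S : Finset G.V) : (S.card : ℝ) ≤ G.spread S := by
  rw [← expect_const G (S.card : ℝ)]
  exact expect_mono fun L _ => Nat.cast_le.2 (Finset.card_le_card (subset_reach S L))

/-- Submodularity of the spread. -/
theorem spread_insert_sub_anti {S T : Finset G.V} (h : S ⊆ T) (v : G.V) :
    G.spread (insert v T) - G.spread T ≤ G.spread (insert v S) - G.spread S := by
  unfold spread
  rw [← expect_sub, ← expect_sub]
  refine expect_mono fun L _ => ?_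
  have hi : ∀ S : Finset G.V, ((G.reach (insert v S) L).card : ℝ) - (G.reach S L).card =
      ((G.reach {v} L \ G.reach S L).card : ℝ) := fun S => by
    rw [reach_eq_biUnion (insert v S), Finset.biUnion_insert, ← reach_eq_biUnion,
      ← Finset.card_sdiff_add_card]
    push_cast
    rw [add_sub_cancel_right]
  rw [hi, hi]
  exact Nat.cast_le.2 (Finset.card_le_card
    (Finset.sdiff_subset_sdiff subset_rfl (reach_mono_left h L)))

theorem spread_le_optN {k : ℕ} {S : Finset G.V} (hS : S.card = G.budget k) :
    G.spread S ≤ G.optN k := by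
  refine le_csSup ⟨(Fintype.card G.V : ℝ), ?_⟩ ⟨S, hS, rfl⟩
  rintro _ ⟨T, -, rfl⟩
  rw [← expect_const G (Fintype.card G.V : ℝ)]
  exact expect_mono fun L _ => Nat.cast_le.2 (Finset.card_le_univ _)

theorem budget_le (k : ℕ) : G.budget k ≤ Fintype.card G.V := min_le_right _ _

theorem one_le_budget {k : ℕ} (hk : 1 ≤ k) : 1 ≤ G.budget k := le_min hk Fintype.card_pos

theorem exists_spread_eq_optN (G : InfluenceGraph.{u}) (k : ℕ) :
    ∃ S : Finset G.V, S.card = G.budget k ∧ G.spread S = G.optN k := by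
  obtain ⟨S₀, -, hS₀⟩ := Finset.exists_subset_card_eq
    (s := (Finset.univ : Finset G.V)) (G.budget_le k)
  have hfin : {x : ℝ | ∃ S : Finset G.V, S.card = G.budget k ∧ x = G.spread S}.Finite :=
    (Set.finite_range G.spread).subset (by rintro _ ⟨S, -, rfl⟩; exact ⟨S, rfl⟩)
  have hne : {x : ℝ | ∃ S : Finset G.V, S.card = G.budget k ∧ x = G.spread S}.Nonempty :=
    ⟨_, S₀, hS₀, rfl⟩
  obtain ⟨S, hS, h⟩ := hne.csSup_mem hfin
  exact ⟨S, hS, h.symm⟩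

theorem budget_le_optN (G : InfluenceGraph.{u}) (k : ℕ) : (G.budget k : ℝ) ≤ G.optN k := by
  obtain ⟨S, hS, h⟩ := G.exists_spread_eq_optN k
  rw [← hS, ← h]
  exact card_le_spread S

theorem budget_mul_spread_le {k : ℕ} {A : Finset G.V} (hA : G.budget k ≤ A.card) :
    G.budget k * G.spread A ≤ A.card * G.optN k := by
  obtain ⟨T, -, hT, h⟩ := Finset.exists_subset_card_eq_mul_le sum_spread_sub_erase_le A hA
  exact h.trans (mul_le_mul_of_nonneg_left (spread_le_optN hT) (Nat.cast_nonneg _))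

/-- Exchange: delete from `S` the element `a` whose loss is at most `N / b`, then add `v`. The
result has admissible size, so its spread is at most `N`. By submodularity the gain of `v` over `S`
is at most its gain over `S.erase a`, which is at most that loss. -/
theorem budget_mul_marginal_le {k : ℕ} (hk : 1 ≤ k) {S : Finset G.V}
    (hS : S.card = G.budget k) (hopt : G.spread S = G.optN k) (v : G.V) :
    G.budget k * (G.spread (insert v S) - G.spread S) ≤ G.optN k := by
  have hb : 1 ≤ G.budget k := one_le_budget hk
  by_cases hv : v ∈ S
  · rw [Finset.insert_eq_of_mem hv, sub_self, mul_zero]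
    exact (Nat.cast_nonneg _).trans (G.budget_le_optN k)
  obtain ⟨a, ha, h⟩ := Finset.exists_erase_mul_le (Finset.card_pos.1 (by omega))
    (sum_spread_sub_erase_le S)
  have h1 := spread_insert_sub_anti (Finset.erase_subset a S) v
  have h2 : G.spread (insert v (S.erase a)) ≤ G.optN k := by
    refine spread_le_optN ?_
    rw [Finset.card_insert_of_notMem fun hh => hv (Finset.mem_of_mem_erase hh),
      Finset.card_erase_add_one ha, hS]
  rw [hS, hopt] at h
  have hb' : (0 : ℝ) ≤ G.budget k := Nat.cast_nonneg _
  calc (G.budget k : ℝ) * (G.spread (insert v S) - G.spread S)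
      ≤ G.budget k * (G.optN k - G.spread (S.erase a)) :=
        mul_le_mul_of_nonneg_left (by linarith) hb'
    _ ≤ G.optN k := by linarith

/-- Nonnegativity of `c` covers the default value `0` of `sSup` on the empty set. -/
theorem optA_le {k : ℕ} {c : ℝ} (hc : 0 ≤ c)
    (h : ∀ π : G.Policy, π.HasSize (G.budget k) → π.spread ≤ c) : G.optA k ≤ c :=
  Real.sSup_le (by rintro _ ⟨π, hπ, rfl⟩; exact h π hπ) hc

theorem optA_le_card (G : InfluenceGraph.{u}) (k : ℕ) : G.optA k ≤ Fintype.card G.V :=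
  optA_le (Nat.cast_nonneg _) fun π _ => π.spread_le_card

theorem budget_mul_optA_le {k : ℕ} (hk : 1 ≤ k) :
    G.budget k * G.optA k ≤ G.optN k * (G.optN k + G.budget k) := by
  have hb : (0 : ℝ) < G.budget k := by exact_mod_cast one_le_budget hk
  have hN : (0 : ℝ) < G.optN k := hb.trans_le (G.budget_le_optN k)
  obtain ⟨S, hS, hopt⟩ := G.exists_spread_eq_optN k
  rw [mul_comm, ← le_div_iff₀ hb]
  refine optA_le (by positivity) fun π hπ => ?_
  have hd : ∀ v, G.spread (insert v S) - G.spread S ≤ G.optN k / G.budget k := fun v => by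
    rw [le_div_iff₀ hb, mul_comm]
    exact budget_mul_marginal_le hk hS hopt v
  refine (hπ.spread_le_expect hd).trans ?_
  have h1 : G.expect (fun L => G.spread (G.reach S L)) ≤
      G.optN k * (G.optN k / G.budget k) := by
    have h2 : ∀ L ⊆ G.edges, G.spread (G.reach S L) ≤
        ((G.reach S L).card : ℝ) * (G.optN k / G.budget k) := fun L _ => by
      rw [← mul_div_assoc, le_div_iff₀ hb, mul_comm]
      exact budget_mul_spread_le (hS ▸ Finset.card_le_card (subset_reach S L))
    refine (expect_mono h2).trans_eq ?_
    rw [expect_mul_const]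
    congr 1
  calc _ ≤ G.optN k * (G.optN k / G.budget k) + G.budget k * (G.optN k / G.budget k) :=
        add_le_add_left h1 _
    _ = _ := by ring

/-- A bound on the spread of single nodes: completing a node to a full seed set gains at least the
average number of nodes that it misses. -/
theorem card_sub_one_mul_le {k : ℕ} (hk : 1 ≤ k) (v : G.V) :
    ((G.budget k : ℝ) - 1) * (Fintype.card G.V - G.spread {v}) ≤
      ((Fintype.card G.V : ℝ) - 1) * (G.optN k - G.spread {v}) := by
  have hb : 1 ≤ G.budget k := one_le_budget hk
  have hbn := G.budget_le k
  have hcard : (Finset.univ.erase v).card = Fintype.card G.V - 1 := by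
    rw [Finset.card_erase_of_mem (Finset.mem_univ v), Finset.card_univ]
  -- One of the `b` seeds is `v` itself. The other `b - 1` are chosen by averaging so as to contain
  -- many nodes missed by `v`, counting only the seeds themselves.
  obtain ⟨T, hT, hTk, h⟩ := Finset.exists_subset_card_eq_mul_le (k := G.budget k - 1)
    (sum_expect_card_biUnion_sub_erase_le fun L a => {a} \ G.reach {v} L)
    (Finset.univ.erase v) (by omega)
  have hU : ∀ (A : Finset G.V) (L : Finset (G.V × G.V)),
      (A.biUnion fun a => {a} \ G.reach {v} L) = A \ G.reach {v} L := fun A L => by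
    ext w
    simp only [Finset.mem_biUnion, Finset.mem_sdiff, Finset.mem_singleton]
    exact ⟨fun ⟨a, ha, hw, h⟩ => ⟨hw ▸ ha, h⟩, fun ⟨a, b⟩ => ⟨w, a, rfl, b⟩⟩
  simp only [hU] at h
  have hvT : v ∉ T := fun hv => Finset.notMem_erase v _ (hT hv)
  have h1 : G.expect (fun L => ((Finset.univ.erase v \ G.reach {v} L).card : ℝ)) =
      Fintype.card G.V - G.spread {v} := by
    rw [← expect_const G (Fintype.card G.V : ℝ), spread, ← expect_sub]
    refine expect_congr fun L _ => ?_
    have hv : v ∈ G.reach {v} L := subset_reach _ _ (Finset.mem_singleton_self v)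
    have : Finset.univ.erase v \ G.reach {v} L = Finset.univ \ G.reach {v} L := by
      ext w
      simp only [Finset.mem_sdiff, Finset.mem_erase, Finset.mem_univ, and_true, true_and]
      exact ⟨fun a => a.2, fun a => ⟨fun b => a (b ▸ hv), a⟩⟩
    rw [this, Finset.cast_card_sdiff (Finset.subset_univ _), Finset.card_univ]
  have h2 : G.expect (fun L => ((T \ G.reach {v} L).card : ℝ)) ≤ G.optN k - G.spread {v} := by
    have hins : G.spread (insert v T) ≤ G.optN k := spread_le_optN (by
      rw [Finset.card_insert_of_notMem hvT, hTk]; omega)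
    refine le_trans ?_ (sub_le_sub_right hins _)
    unfold spread
    rw [← expect_sub]
    refine expect_mono fun L _ => ?_
    rw [le_sub_iff_add_le]
    have : ((T \ G.reach {v} L).card + (G.reach {v} L).card) ≤ (G.reach (insert v T) L).card := by
      rw [Finset.card_sdiff_add_card]
      exact Finset.card_le_card (Finset.union_subset
        ((Finset.subset_insert v T).trans (subset_reach _ L))
        (reach_mono_left (by simp) L))
    exact_mod_cast this
  rw [h1, hcard, Nat.cast_sub hb, Nat.cast_sub (hb.trans hbn), Nat.cast_one] at h
  refine h.trans (mul_le_mul_of_nonneg_left h2 ?_)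
  rw [sub_nonneg]
  exact_mod_cast hb.trans hbn

theorem optA_le_mul_optN {k m : ℕ} (hk : 1 ≤ k) (hm : Fintype.card G.V ≤ m ^ 3) :
    G.optA k ≤ m * G.optN k := by
  have hb1 : 1 ≤ G.budget k := one_le_budget hk
  have hbN := G.budget_le_optN k
  have hA := G.optA_le_card k
  have hmR : (Fintype.card G.V : ℝ) ≤ (m : ℝ) ^ 3 := by exact_mod_cast hm
  have hbR : (1 : ℝ) ≤ G.budget k := by exact_mod_cast hb1
  have hbn : (G.budget k : ℝ) ≤ Fintype.card G.V := by exact_mod_cast G.budget_le k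
  have hNpos : 0 < G.optN k := by linarith
  by_cases hcase : (Fintype.card G.V : ℝ) ≤ m * G.optN k
  · exact hA.trans hcase
  rw [not_le] at hcase
  -- `m = 0` contradicts nonemptiness; `m = 1` contradicts `N ≥ b ≥ 1` with `N < n ≤ 1`.
  have hm2 : 2 ≤ m := by
    by_contra! hlt
    interval_cases m
    · norm_num at hmR
    · rw [Nat.cast_one] at hmR hcase
      linarith
  have hm2R : (2 : ℝ) ≤ m := by exact_mod_cast hm2
  have hNm : G.optN k < (m : ℝ) ^ 2 := by
    have : (m : ℝ) * G.optN k < m * (m : ℝ) ^ 2 := by nlinarith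
    exact lt_of_mul_lt_mul_left this (by linarith)
  obtain ⟨v, -, hv⟩ := Finset.exists_max_image Finset.univ (fun v => G.spread {v})
    Finset.univ_nonempty
  have hs : ∀ w, G.spread {w} ≤ G.spread {v} := fun w => hv w (Finset.mem_univ w)
  have hs0 : 0 ≤ G.spread {v} := (Nat.cast_nonneg _).trans (card_le_spread _)
  have hAs : G.optA k ≤ G.budget k * G.spread {v} :=
    optA_le (by positivity) fun π hπ => hπ.spread_le_mul hs
  have hav := card_sub_one_mul_le hk v
  rcases Nat.lt_trichotomy (G.budget k) (m + 1) with hlt | heq | hgt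
  · have hbm : (G.budget k : ℝ) ≤ m := by exact_mod_cast Nat.lt_succ_iff.1 hlt
    have hsN : G.spread {v} ≤ G.optN k := by
      obtain ⟨T, hvT, -, hT⟩ := Finset.exists_subsuperset_card_eq
        (Finset.subset_univ {v}) (by simpa using hb1) (G.budget_le k)
      exact (spread_mono hvT).trans (spread_le_optN hT)
    exact hAs.trans (by gcongr)
  · have hbm : (G.budget k : ℝ) = m + 1 := by exact_mod_cast heq
    rw [hbm] at hAs hav hbn
    rw [add_sub_cancel_right] at hav
    refine hAs.trans ?_
    generalize (Fintype.card G.V : ℝ) = n at *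
    generalize G.spread {v} = s at *
    generalize G.optN k = N at *
    by_contra! hcon
    have h1 : m * n ≤ (n - 1) * N - (n - 1 - m) * s := by linarith
    -- The factor is nonnegative because `b = m + 1 ≤ n`. Adding this to `(m + 1)` times `h1`
    -- eliminates `s` and gives `h3`.
    have h2 : (n - 1 - m) * (m * N) ≤ (n - 1 - m) * ((m + 1) * s) :=
      mul_le_mul_of_nonneg_left hcon.le (by linarith)
    have h3 : (m + 1) * (m * n) ≤ N * (n - 1 + m ^ 2) := by
      nlinarith
    have h4 : m * ((m + 1) * (m * n)) < n * (n - 1 + (m : ℝ) ^ 2) := by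
      have h5 : (0 : ℝ) < n - 1 + (m : ℝ) ^ 2 := by nlinarith
      calc m * ((m + 1) * (m * n)) ≤ m * (N * (n - 1 + m ^ 2)) := by gcongr
        _ = (m * N) * (n - 1 + m ^ 2) := by ring
        _ < _ := mul_lt_mul_of_pos_right hcase h5
    have h6 : (0 : ℝ) < n := by linarith
    have h7 : n * (m * (m + 1) * m) < n * (n - 1 + (m : ℝ) ^ 2) := by linarith
    have h8 := lt_of_mul_lt_mul_left h7 h6.le
    -- What remains is `m ^ 3 + m ^ 2 < n - 1 + m ^ 2`, contrary to `n ≤ m ^ 3`.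
    nlinarith
  · have hbm : (m : ℝ) + 2 ≤ G.budget k := by exact_mod_cast hgt
    have h1 := budget_mul_optA_le (G := G) hk
    -- `(m - 1) * b ≥ (m - 1) * (m + 2) = m ^ 2 + m - 2 ≥ m ^ 2 > N`, using `m ≥ 2`.
    have h2 : G.optN k + G.budget k ≤ m * G.budget k := by nlinarith
    refine le_of_mul_le_mul_left (h1.trans ?_) (by linarith : (0 : ℝ) < G.budget k)
    calc G.optN k * (G.optN k + G.budget k) ≤ G.optN k * (m * G.budget k) := by gcongr
      _ = _ := by ring

end InfluenceGraph

/-! ### The cube root, and the final bound. -/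

theorem Nat.le_ceil_rpow_one_div_three_pow (n : ℕ) :
    n ≤ ⌈(n : ℝ) ^ ((1 : ℝ) / 3)⌉₊ ^ 3 := by
  have h : (n : ℝ) = ((n : ℝ) ^ ((1 : ℝ) / 3)) ^ 3 := by
    rw [← Real.rpow_natCast, ← Real.rpow_mul (Nat.cast_nonneg n)]
    norm_num
  have h2 : (n : ℝ) ≤ (⌈(n : ℝ) ^ ((1 : ℝ) / 3)⌉₊ : ℝ) ^ 3 := by
    conv_lhs => rw [h]
    gcongr
    exact Nat.le_ceil _
  exact_mod_cast h2

theorem theorem4p2 (n : ℕ) :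
    adaptivityGap (graphsOfSizeAtMost.{u} n) ≤
      (((⌈(n : ℝ) ^ ((1 : ℝ) / 3)⌉₊ : ℕ) : ℝ) : EReal) := by
  refine iSup₂_le fun k hk => iSup₂_le fun G hG => EReal.coe_le_coe_iff.2 ?_
  have hpos : 0 < G.optN k := lt_of_lt_of_le
    (by exact_mod_cast InfluenceGraph.one_le_budget (G := G) hk) (G.budget_le_optN k)
  rw [div_le_iff₀ hpos]
  exact InfluenceGraph.optA_le_mul_optN hk
    (le_trans hG (Nat.le_ceil_rpow_one_div_three_pow n))
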